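/- Let $K,K'$ be division rings such that $|K|\geq 4$, or $|K|=3$ and $\operatorname{char}K'=3$. Let $V$ be a left $K$-vector space and $V'$ a left $K'$-vector space, of arbitrary dimension, and let $\mathbb P=\mathbb P(V)$, $\mathbb P'=\mathbb P(V')$ be the projective spaces of their one-dimensional subspaces; the subspaces of $\mathbb P(V)$ are the sets $\mathbb P(W)$ with $W\subseteq V$ a vector subspace, and a hyperplane is a maximal proper subspace. Let $X\subseteq\mathbb P$ be an affino-projective subset, i.e. $X\cup H=\mathbb P$ for some hyperplane $H$ of $\mathbb P$. Regard $X$ as a subgeometry of $\mathbb P$: its subspaces are the sets $S\cap X$ with $S$ a subspace of $\mathbb P$. Let $\varphi\colon X\to\mathbb P'$ be a morphism, i.e. a map such that $\varphi^{-1}(S')$ is a subspace of $X$ for every subspace $S'$ of $\mathbb P'$, and assume that the image of $\varphi$ is not contained in a line of $\mathbb P'$ (nor reduced to a point), that is, not contained in $\mathbb P(W')$ for any vector subspace $W'\subseteq V'$ with $\dim W'\leq 2$. Then $\varphi$ is the restriction of a unique partial projective morphism $\phi\colon\mathbb P\dashrightarrow\mathbb P'$. Here a partial projective morphism is a partial map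 of the form $\langle v\rangle\mapsto\langle\Phi(v)\rangle$, with domain exactly $\mathbb P(V)\setminus\mathbb P(\ker\Phi)$, where $\Phi\colon V\to V'$ is additive and satisfies $\Phi(\lambda v)=\sigma(\lambda)\Phi(v)$ for some (unital, not necessarily surjective) ring morphism $\sigma\colon K\to K'$. That $\varphi$ is the restriction of $\phi$ means that $X$ is contained in the domain of $\phi$ and $\phi(x)=\varphi(x)$ for all $x\in X$. -/

import Mathlib

open scoped LinearAlgebra.Projectivization

universe u v

/-! ### Geometries -/

/-- The closure of `A` relative to a family `F` of subsets: the intersection of the members of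
`F` that contain `A`. -/
def flatClosure {X : Type u} (F : Set (Set X)) (A : Set X) : Set X :=
  ⋂₀ {T | T ∈ F ∧ A ⊆ T}

theorem subset_flatClosure {X : Type u} (F : Set (Set X)) (A : Set X) : A ⊆ flatClosure F A :=
  fun _ hx _ hT => hT.2 hx

theorem flatClosure_subset {X : Type u} {F : Set (Set X)} {A T : Set X} (hT : T ∈ F)
    (h : A ⊆ T) : flatClosure F A ⊆ T :=
  fun _ hx => hx T ⟨hT, h⟩

theorem flatClosure_mono {X : Type u} (F : Set (Set X)) {A B : Set X} (h : A ⊆ B) :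
    flatClosure F A ⊆ flatClosure F B :=
  fun _ hx T hT => hx T ⟨hT.1, h.trans hT.2⟩

/-- A geometry on a set `X` of points: a family of subsets, called subspaces or flats, which
contains `∅`, `X` and the points, is closed under intersections, and satisfies the exchange axiom
and the finitary axiom. -/
structure Geometry (X : Type u) where
  flats : Set (Set X)
  empty_mem : ∅ ∈ flats
  univ_mem : Set.univ ∈ flats
  singleton_mem : ∀ x : X, {x} ∈ flats
  sInter_mem : ∀ F ⊆ flats, ⋂₀ F ∈ flats
  exchange : ∀ S ∈ flats, ∀ x ∉ S,
    ¬ ∃ S' ∈ flats, S ⊂ S' ∧ S' ⊂ flatClosure flats (S ∪ {x})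
  finitary : ∀ (A : Set X), ∀ x ∈ flatClosure flats A,
    ∃ B : Set X, B ⊆ A ∧ B.Finite ∧ x ∈ flatClosure flats B

namespace Geometry

theorem flatClosure_mem {X : Type u} (G : Geometry X) (A : Set X) :
    flatClosure G.flats A ∈ G.flats :=
  G.sInter_mem _ fun _ hT => hT.1

/-- The flats of the subgeometry on `A`: the traces on `A` of the flats of `G`. -/
def traceFlats {X : Type u} (G : Geometry X) (A : Set X) : Set (Set A) :=
  {T | ∃ S ∈ G.flats, T = Subtype.val ⁻¹' S}

theorem flatClosure_traceFlats {X : Type u} (G : Geometry X) (A : Set X) (B : Set A) :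
    flatClosure (G.traceFlats A) B =
      Subtype.val ⁻¹' (flatClosure G.flats (Subtype.val '' B)) := by
  apply Set.Subset.antisymm
  · refine flatClosure_subset ⟨_, G.flatClosure_mem _, rfl⟩ ?_
    exact Set.image_subset_iff.1 (subset_flatClosure _ _)
  · rintro x hx _ ⟨⟨S, hS, rfl⟩, hBS⟩
    exact hx S ⟨hS, Set.image_subset_iff.2 hBS⟩

/-- The subgeometry of `G` on a subset `A` of its points. -/
def subgeometry {X : Type u} (G : Geometry X) (A : Set X) : Geometry A where
  flats := G.traceFlats A
  empty_mem := ⟨∅, G.empty_mem, rfl⟩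
  univ_mem := ⟨Set.univ, G.univ_mem, rfl⟩
  singleton_mem x := ⟨{x.1}, G.singleton_mem x.1, by ext y; simp [Subtype.ext_iff]⟩
  sInter_mem F hF := by
    refine ⟨⋂₀ {S | S ∈ G.flats ∧ Subtype.val ⁻¹' S ∈ F}, G.sInter_mem _ fun _ h => h.1, ?_⟩
    ext x
    constructor
    · rintro hx S ⟨-, hS⟩
      exact hx _ hS
    · intro hx T hT
      obtain ⟨S, hS, rfl⟩ := hF hT
      exact hx S ⟨hS, hT⟩
  exchange := by
    rintro S hS x hxS ⟨S', hS', hlt, hlt'⟩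
    have key : ∀ T ∈ G.traceFlats A,
        Subtype.val ⁻¹' (flatClosure G.flats (Subtype.val '' T)) = T := by
      intro T hT
      rw [← G.flatClosure_traceFlats A T]
      exact (flatClosure_subset hT subset_rfl).antisymm (subset_flatClosure _ _)
    refine G.exchange _ (G.flatClosure_mem (Subtype.val '' S)) x.1 ?_
      ⟨_, G.flatClosure_mem (Subtype.val '' S'), ?_, ?_⟩
    · intro h
      apply hxS
      rw [← key S hS]
      exact h
    · refine (flatClosure_mono _ (Set.image_mono hlt.subset)).ssubset_of_ne fun h => hlt.ne ?_
      rw [← key S hS, ← key S' hS', h]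
    · have h1 : flatClosure G.flats (Subtype.val '' (S ∪ {x})) ⊆
          flatClosure G.flats (flatClosure G.flats (Subtype.val '' S) ∪ {x.1}) := by
        apply flatClosure_mono
        rw [Set.image_union, Set.image_singleton]
        exact Set.union_subset_union_left _ (subset_flatClosure _ _)
      have h2 : flatClosure G.flats (Subtype.val '' S') ⊆
          flatClosure G.flats (Subtype.val '' (S ∪ {x})) := by
        refine flatClosure_subset (G.flatClosure_mem _) ?_
        rw [Set.image_subset_iff, ← G.flatClosure_traceFlats]
        exact hlt'.subset
      refine (h2.trans h1).ssubset_of_ne fun h => hlt'.ne ?_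
      refine hlt'.subset.antisymm ?_
      rw [G.flatClosure_traceFlats]
      conv_rhs => rw [← key S' hS', h]
      exact fun y hy => h1 hy
  finitary := by
    intro B x hx
    rw [G.flatClosure_traceFlats] at hx
    obtain ⟨C, hCB, hC, hxC⟩ := G.finitary _ _ hx
    refine ⟨Subtype.val ⁻¹' C, ?_, hC.preimage Subtype.val_injective.injOn, ?_⟩
    · intro y hy
      obtain ⟨z, hz, hzy⟩ := hCB hy
      rwa [← Subtype.val_injective hzy]
    · rw [G.flatClosure_traceFlats]
      have : Subtype.val '' (Subtype.val ⁻¹' C : Set A) = C := by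
        rw [Subtype.image_preimage_coe, Set.inter_eq_right]
        intro y hy
        obtain ⟨z, -, rfl⟩ := hCB hy
        exact z.2
      rw [this]
      exact hxC

/-- A morphism of geometries: the preimage of every flat is a flat. -/
def IsMorphism {X : Type u} {Y : Type v} (G : Geometry X) (G' : Geometry Y) (f : X → Y) : Prop :=
  ∀ S ∈ G'.flats, f ⁻¹' S ∈ G.flats

/-- A hyperplane: a maximal proper flat. -/
def IsHyperplane {X : Type u} (G : Geometry X) (H : Set X) : Prop :=
  H ∈ G.flats ∧ H ≠ Set.univ ∧ ∀ S ∈ G.flats, H ⊂ S → S = Set.univ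

/-- `A` is affino-projective: it covers the geometry together with some hyperplane. -/
def IsAffinoProjective {X : Type u} (G : Geometry X) (A : Set X) : Prop :=
  ∃ H : Set X, G.IsHyperplane H ∧ A ∪ H = Set.univ

end Geometry

/-! ### The projective space of a vector space -/

section Projective

variable (K : Type u) (V : Type v) [DivisionRing K] [AddCommGroup V] [Module K V]

theorem flatClosure_projective (A : Set (ℙ K V)) :
    flatClosure (Set.range ((↑) : Projectivization.Subspace K V → Set (ℙ K V))) A =
      Projectivization.Subspace.span A := by
  apply Set.Subset.antisymm
  · exact flatClosure_subset ⟨_, rfl⟩ (Projectivization.Subspace.subset_span A)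
  · rintro x hx _ ⟨⟨W, rfl⟩, hA⟩
    exact (Projectivization.Subspace.span_le_subspace_iff.2 hA) hx

theorem projective_sup_point (W : Projectivization.Subspace K V) (x : ℙ K V) :
    Projectivization.Subspace.span ((W : Set (ℙ K V)) ∪ {x}) =
      (W.submodule ⊔ x.submodule).projectivization := by
  apply le_antisymm
  · rw [Projectivization.Subspace.span_le_subspace_iff]
    rintro y (hy | hy)
    · induction y with
      | h w hw =>
        change _ ∈ Submodule.projectivization _
        rw [Submodule.mk_mem_projectivization_iff]
        exact Submodule.mem_sup_left ((W.mem_submodule_iff hw).2 hy)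
    · obtain rfl : y = x := hy
      change _ ∈ Submodule.projectivization _
      rw [Submodule.mem_projectivization_iff_submodule_le]
      exact le_sup_right
  · rw [← OrderIso.le_symm_apply, OrderIso.symm_symm]
    refine sup_le ?_ ?_
    · rw [OrderIso.le_iff_le]
      exact fun y hy => Projectivization.Subspace.subset_span _ (Or.inl hy)
    · have := Projectivization.Subspace.subset_span ((W : Set (ℙ K V)) ∪ {x})
        (show x ∈ (W : Set (ℙ K V)) ∪ {x} from Or.inr rfl)
      induction x with
      | h w hw =>
        rw [Projectivization.submodule_mk, Submodule.span_singleton_le_iff_mem,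
          Projectivization.Subspace.mem_submodule_iff _ hw]
        exact this

/-- The projective space of `V` as a geometry: its flats are the projective subspaces. -/
def projectiveGeometry : Geometry (ℙ K V) where
  flats := Set.range ((↑) : Projectivization.Subspace K V → Set (ℙ K V))
  empty_mem := ⟨⊥, Projectivization.Subspace.bot_coe⟩
  univ_mem := ⟨Projectivization.Subspace.span Set.univ,
    Set.univ_subset_iff.1 (Projectivization.Subspace.subset_span Set.univ)⟩
  singleton_mem x := by
    refine ⟨x.submodule.projectivization, ?_⟩
    ext y
    change y ∈ Submodule.projectivization _ ↔ _
    rw [Submodule.mem_projectivization_iff_submodule_le, Set.mem_singleton_iff]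
    refine ⟨fun h => ?_, fun h => h ▸ le_rfl⟩
    apply Projectivization.submodule_injective
    exact Submodule.eq_of_le_of_finrank_eq h
      (y.finrank_submodule.trans x.finrank_submodule.symm)
  sInter_mem F hF := by
    refine ⟨sInf {W | (W : Set (ℙ K V)) ∈ F}, ?_⟩
    ext x
    constructor
    · intro hx T hT
      obtain ⟨W, rfl⟩ := hF hT
      exact hx _ ⟨W, hT, rfl⟩
    · rintro hx _ ⟨W, hW, rfl⟩
      exact hx _ hW
  exchange := by
    rintro _ ⟨W, rfl⟩ x hx ⟨_, ⟨W', rfl⟩, h1, h2⟩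
    rw [flatClosure_projective, projective_sup_point] at h2
    have hcov : W.submodule ⋖ W.submodule ⊔ x.submodule := by
      induction x with
      | h w hw =>
        rw [Projectivization.submodule_mk]
        rw [sup_comm]
        exact Submodule.covBy_span_singleton_sup (mt (W.mem_submodule_iff hw).1 hx)
    refine hcov.2 (c := W'.submodule) ?_ ?_
    · exact Projectivization.Subspace.submodule.lt_iff_lt.2 h1
    · rw [← OrderIso.lt_symm_apply]
      exact h2
  finitary := by
    intro A x hx
    rw [flatClosure_projective] at hx
    simp only [flatClosure_projective]
    change Projectivization.Subspace.spanCarrier A x at hx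
    induction hx with
    | of y hy =>
      exact ⟨{y}, by simpa using hy, Set.finite_singleton y,
        Projectivization.Subspace.subset_span _ rfl⟩
    | mem_add a b ha hb hab _ _ iha ihb =>
      obtain ⟨B, hBA, hB, hxB⟩ := iha
      obtain ⟨C, hCA, hC, hxC⟩ := ihb
      refine ⟨B ∪ C, Set.union_subset hBA hCA, hB.union hC, ?_⟩
      exact Projectivization.Subspace.mem_add _ _ _ ha hb hab
        (Projectivization.Subspace.monotone_span Set.subset_union_left hxB)
        (Projectivization.Subspace.monotone_span Set.subset_union_right hxC)

end Projective

/-! ### Partial projective morphisms -/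

section PartialProjective

variable {K : Type*} {V : Type*} [DivisionRing K] [AddCommGroup V] [Module K V]
  {K' : Type*} {V' : Type*} [DivisionRing K'] [AddCommGroup V'] [Module K' V']

/-- The partial map `⟨v⟩ ↦ ⟨Φ v⟩` of projective spaces induced by a semilinear map `Φ`, defined
exactly at the points `⟨v⟩` with `Φ v ≠ 0`, that is, outside the projectivization of the kernel
of `Φ`. -/
noncomputable def partialProjectivization {σ : K →+* K'} (Φ : V →ₛₗ[σ] V') : ℙ K V →. ℙ K' V' :=
  fun x => ⟨Φ x.rep ≠ 0, fun h => Projectivization.mk K' (Φ x.rep) h⟩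

/-- The induced partial map does not depend on the chosen representatives. -/
theorem mem_partialProjectivization_mk {σ : K →+* K'} (Φ : V →ₛₗ[σ] V') (v : V) (hv : v ≠ 0)
    (y : ℙ K' V') :
    y ∈ partialProjectivization Φ (Projectivization.mk K v hv) ↔
      ∃ h : Φ v ≠ 0, y = Projectivization.mk K' (Φ v) h := by
  obtain ⟨a, ha⟩ := Projectivization.exists_smul_eq_mk_rep K v hv
  have hΦ : Φ (Projectivization.mk K v hv).rep = σ a • Φ v := by
    rw [← ha, Units.smul_def, LinearMap.map_smulₛₗ]
  have ha' : σ (a : K) ≠ 0 := (map_ne_zero σ).2 a.ne_zero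
  constructor
  · rintro ⟨h, rfl⟩
    have h' : Φ v ≠ 0 := fun h0 => h (by rw [hΦ, h0, smul_zero])
    refine ⟨h', ?_⟩
    exact (Projectivization.mk_eq_mk_iff' K' _ _ _ _).2 ⟨σ a, hΦ.symm⟩
  · rintro ⟨h, rfl⟩
    refine ⟨?_, ?_⟩
    · change Φ _ ≠ 0
      rw [hΦ]
      exact smul_ne_zero ha' h
    · exact (Projectivization.mk_eq_mk_iff' K' _ _ _ _).2 ⟨σ a, hΦ.symm⟩

/-- A partial projective morphism: a partial map induced by some semilinear map, with respect to
an arbitrary ring morphism `σ : K → K'`. -/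
def IsPartialProjectiveMorphism (φ : ℙ K V →. ℙ K' V') : Prop :=
  ∃ (σ : K →+* K') (Φ : V →ₛₗ[σ] V'), φ = partialProjectivization Φ

end PartialProjective

/-
Write the complement of the hyperplane as the affine space `v₀ + ker l`, and lift `f` to vectors. On
a plane with noncollinear image, two parallel columns go to two lines meeting in a point `⟨d⟩`, and
affine coordinates on these lines turn the two columns into maps `τ, θ : K → K'`. Projecting one
column onto the other from points of the plane gives relations `τ z = c + β * θ (r + n * z)` for
`n ≠ 0, 1`; comparing several values of `n` (or, over the field with three elements, using
characteristic `3`) forces `τ` and `θ` to be one and the same ring morphism `σ`. Hence `f` is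
semiaffine on such planes. Planes through `v₀` are glued: the direction in which `f` moves away from
`f v₀` is semilinear off the proper submodule of the points sent to `f v₀`, and such a map extends
to the whole space. The remaining points, including those on the hyperplane, are reached by
intersecting two image lines.
-/

section FunctionalEquation

open Cardinal

variable {K K' : Type*} [DivisionRing K] [DivisionRing K']

theorem map_add_of_affine_equivariant (hK : 3 ≤ #K) (ψ : K →*₀ K')
    (h : ∀ r, ∃ c β : K', ∀ z, ψ (z + r) = c + β * ψ z) (x y : K) :
    ψ (x + y) = ψ x + ψ y := by
  obtain ⟨b, hb⟩ : ∃ b, b = -(ψ (-1))⁻¹ := ⟨_, rfl⟩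
  have translate (r : K) (hr : r ≠ 0) (z : K) : ψ (z + r) = ψ r + b * ψ z := by
    obtain ⟨c, β, hcβ⟩ := h r
    have hc : ψ r = c := by simpa using hcβ 0
    have hβ : (1 + β * ψ (-1)) * ψ r = 0 := by
      have := hcβ (-r)
      rw [neg_add_cancel, map_zero, ← neg_one_mul, map_mul, ← hc] at this
      rw [add_mul, one_mul, mul_assoc, ← this]
    have hβ' : β * ψ (-1) = -1 :=
      (neg_eq_of_add_eq_zero_right ((mul_eq_zero.1 hβ).resolve_right (by simpa using hr))).symm
    rw [hcβ, hb, (eq_mul_inv_iff_mul_eq₀ (by simp)).2 hβ', neg_one_mul, hc]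
  have hb1 : b = 1 := by
    by_contra hne
    -- Comparing `ψ (1 + r)` with `ψ (r + 1)` shows that `ψ` is constant away from `0`.
    have constant (r : K) (hr : r ≠ 0) : ψ r = 1 := by
      have hcomm := translate r hr 1
      rw [add_comm, translate 1 one_ne_zero, map_one, mul_one] at hcomm
      have : (1 - b) * (ψ r - 1) = 0 := by
        rw [← sub_eq_zero.2 hcomm.symm]
        noncomm_ring
      exact sub_eq_zero.1 ((mul_eq_zero.1 this).resolve_left (sub_ne_zero.2 (Ne.symm hne)))
    obtain ⟨r, hr0, hr1⟩ := exists_ne_ne_of_three_le hK 0 (-1)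
    have hsum := translate r hr0 1
    rw [constant r hr0, constant _ (fun h => hr1 (eq_neg_of_add_eq_zero_right h)), map_one, hb,
      constant (-1) (by simp)] at hsum
    simp at hsum
  rcases eq_or_ne y 0 with rfl | hy
  · simp
  · rw [translate y hy, hb1, one_mul, add_comm]

theorem exists_ringHom_of_affine_equivariant (hK : 3 ≤ #K) {θ : K → K'}
    (h0 : θ 0 = 0) (h1 : θ 1 = 1)
    (h : ∀ k, k ≠ 0 → ∀ r, ∃ c β : K', ∀ z, θ (k * z + r) = c + β * θ z) :
    ∃ σ : K →+* K', ∀ z, θ z = σ z := by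
  have map_mul (k z : K) : θ (k * z) = θ k * θ z := by
    rcases eq_or_ne k 0 with rfl | hk
    · simp only [zero_mul, h0]
    obtain ⟨c, β, hcβ⟩ := h k hk 0
    have hc : c = 0 := by simpa [h0] using (hcβ 0).symm
    have hβ : θ k = β := by simpa [h1, hc] using hcβ 1
    simpa [hc, hβ] using hcβ z
  let ψ : K →*₀ K' := { toFun := θ, map_zero' := h0, map_one' := h1, map_mul' := map_mul }
  have translate (r : K) : ∃ c β : K', ∀ z, θ (z + r) = c + β * θ z := by
    simpa only [one_mul] using h 1 one_ne_zero r
  exact ⟨{ ψ with map_add' := map_add_of_affine_equivariant hK ψ translate }, fun _ => rfl⟩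

theorem eq_zmodCast_of_reflection_relation [CharP K' 3] {τ θ : ZMod 3 → K'} (hτ0 : τ 0 = 0)
    (hτ1 : τ 1 = 1) (hθ0 : θ 0 = 0) (hθ1 : θ 1 = 1)
    (h : ∀ r, ∃ c β : K', ∀ z, τ z = c + β * θ (r - z)) :
    (∀ z, τ z = z.cast) ∧ ∀ z, θ z = z.cast := by
  have two_eq : (1 : ZMod 3) - -1 = -1 := by decide
  have three_eq_zero : (3 : K') = 0 := by exact_mod_cast CharP.cast_eq_zero K' 3
  obtain ⟨c, β, h₀⟩ := h 0
  obtain ⟨c', β', h₁⟩ := h 1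
  have hc : c = 0 := by simpa [hθ0, hτ0] using (h₀ 0).symm
  have hβ : τ (-1) = β := by simpa [hc, hθ1] using h₀ (-1)
  have hβθ : 1 = β * θ (-1) := by simpa [hc, hτ1] using h₀ 1
  have hc' : 1 = c' := by simpa [hθ0, hτ1] using h₁ 1
  have hβ' : β' = -1 :=
    eq_neg_of_add_eq_zero_right (by simpa [hτ0, hθ1, ← hc'] using (h₁ 0).symm)
  have hτθ : τ (-1) = 1 - θ (-1) := by
    simpa [two_eq, ← hc', hβ', sub_eq_add_neg] using h₁ (-1)
  have hθ : θ (-1) = -1 := by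
    have : (θ (-1) + 1) * (θ (-1) + 1) = 1 - (1 - θ (-1)) * θ (-1) + 3 * θ (-1) := by noncomm_ring
    rw [← hτθ, hβ, ← hβθ, three_eq_zero, zero_mul, sub_self, add_zero] at this
    exact eq_neg_of_add_eq_zero_left (mul_self_eq_zero.1 this)
  have hτ : τ (-1) = -1 := by
    rw [hτθ, hθ, sub_neg_eq_add, one_add_one_eq_two, ← sub_eq_zero]
    exact (by norm_num : (2 : K') - -1 = 3).trans three_eq_zero
  have cases (z : ZMod 3) : z = 0 ∨ z = 1 ∨ z = -1 := by decide +revert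
  constructor <;> intro z <;> rcases cases z with rfl | rfl | rfl <;>
    simp [hτ0, hτ1, hτ, hθ0, hθ1, hθ]

theorem exists_ringHom_of_affine_relation_of_four_le_card (hK : 4 ≤ #K) {τ θ : K → K'}
    (hτ0 : τ 0 = 0) (hτ1 : τ 1 = 1) (hθ0 : θ 0 = 0) (hθ1 : θ 1 = 1)
    (h : ∀ n, n ≠ 0 → n ≠ 1 → ∀ r, ∃ c β : K', ∀ z, τ z = c + β * θ (r + n * z)) :
    ∃ σ : K →+* K', (∀ z, τ z = σ z) ∧ ∀ z, θ z = σ z := by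
  have three_le : 3 ≤ #K := le_trans (by norm_num) hK
  have ne_zero {n r c β} (hcβ : ∀ z, τ z = c + β * θ (r + n * z)) : β ≠ 0 := by
    rintro rfl
    exact zero_ne_one (hτ0.symm.trans ((hcβ 0).trans (by simpa [hτ1] using (hcβ 1).symm)))
  obtain ⟨σ, hσ⟩ := exists_ringHom_of_affine_equivariant three_le hθ0 hθ1 fun k hk r => by
    obtain ⟨n, hn⟩ := exists_notMem_of_length_lt [0, 1, k⁻¹]
      (lt_of_lt_of_le (by simp only [List.length_cons, List.length_nil]; norm_num) hK)
    simp only [List.mem_cons, List.not_mem_nil, or_false, not_or] at hn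
    obtain ⟨hn0, hn1, hnk⟩ := hn
    obtain ⟨c, β, hcβ⟩ := h n hn0 hn1 0
    obtain ⟨c', β', hcβ'⟩ := h (k * n) (mul_ne_zero hk hn0)
      (fun h => hnk (eq_inv_of_mul_eq_one_right h)) r
    refine ⟨β'⁻¹ * (c - c'), β'⁻¹ * β, fun z => ?_⟩
    have := hcβ (n⁻¹ * z)
    rw [hcβ', zero_add, mul_assoc, mul_inv_cancel_left₀ hn0] at this
    rw [add_comm, mul_assoc, ← mul_add, eq_inv_mul_iff_mul_eq₀ (ne_zero hcβ'),
      sub_add_eq_add_sub, ← this, add_sub_cancel_left]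
  refine ⟨σ, fun z => ?_, hσ⟩
  obtain ⟨n, hn0, hn1⟩ := exists_ne_ne_of_three_le three_le 0 1
  obtain ⟨c, β, hcβ⟩ := h n hn0 hn1 0
  have hc : c = 0 := by simpa [hτ0, hθ0] using (hcβ 0).symm
  have hβ : 1 = β * σ n := by simpa [hτ1, hc, hσ] using hcβ 1
  rw [hcβ, hc, hσ, zero_add, zero_add, map_mul, ← mul_assoc, ← hβ, one_mul]

theorem exists_ringHom_of_affine_relation_of_card_eq_three (hK : #K = 3) [CharP K' 3] {τ θ : K → K'}
    (hτ0 : τ 0 = 0) (hτ1 : τ 1 = 1) (hθ0 : θ 0 = 0) (hθ1 : θ 1 = 1)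
    (h : ∀ n, n ≠ 0 → n ≠ 1 → ∀ r, ∃ c β : K', ∀ z, τ z = c + β * θ (r + n * z)) :
    ∃ σ : K →+* K', (∀ z, τ z = σ z) ∧ ∀ z, θ z = σ z := by
  have : Finite K := Cardinal.lt_aleph0_iff_finite.1 (hK ▸ Cardinal.ofNat_lt_aleph0)
  have := Fintype.ofFinite K
  have hcard : Fintype.card K = 3 := by exact_mod_cast (Cardinal.mk_fintype K).symm.trans hK
  let e : ZMod 3 ≃+* K := ZMod.ringEquivOfPrime K Nat.prime_three hcard
  have neg_one_ne_one : (-1 : K) ≠ 1 := by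
    simpa only [map_neg, map_one] using e.injective.ne (by decide : (-1 : ZMod 3) ≠ 1)
  obtain ⟨hτ, hθ⟩ := eq_zmodCast_of_reflection_relation (τ := τ ∘ e) (θ := θ ∘ e)
    (by simpa) (by simpa) (by simpa) (by simpa) fun r => by
      obtain ⟨c, β, hcβ⟩ := h (-1) (by simp) neg_one_ne_one (e r)
      exact ⟨c, β, fun z => by simp [hcβ, sub_eq_add_neg]⟩
  exact ⟨(ZMod.castHom dvd_rfl K').comp (e.symm : K →+* ZMod 3),
    e.surjective.forall.2 fun z => by simpa using hτ z,
    e.surjective.forall.2 fun z => by simpa using hθ z⟩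

theorem exists_ringHom_of_affine_relation
    (hK : 4 ≤ #K ∨ (#K = 3 ∧ CharP K' 3)) {τ θ : K → K'}
    (hτ0 : τ 0 = 0) (hτ1 : τ 1 = 1) (hθ0 : θ 0 = 0) (hθ1 : θ 1 = 1)
    (h : ∀ n, n ≠ 0 → n ≠ 1 → ∀ r, ∃ c β : K', ∀ z, τ z = c + β * θ (r + n * z)) :
    ∃ σ : K →+* K', (∀ z, τ z = σ z) ∧ ∀ z, θ z = σ z := by
  rcases hK with hK | ⟨hK, _⟩
  · exact exists_ringHom_of_affine_relation_of_four_le_card hK hτ0 hτ1 hθ0 hθ1 h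
  · exact exists_ringHom_of_affine_relation_of_card_eq_three hK hτ0 hτ1 hθ0 hθ1 h

end FunctionalEquation

section LinearAlgebra

open Submodule

variable {K V : Type*} [DivisionRing K] [AddCommGroup V] [Module K V]

theorem eq_top_of_forall_notMem_mem {N M : Submodule K V} (hN : N ≠ ⊤) (h : ∀ x ∉ N, x ∈ M) :
    M = ⊤ := by
  obtain ⟨z, -, hz⟩ := SetLike.exists_of_lt hN.lt_top
  refine eq_top_iff'.2 fun x => ?_
  by_cases hx : x ∈ N
  · exact (add_mem_cancel_right (h z hz)).1 (h _ fun hxz => hz ((add_mem_cancel_left hx).1 hxz))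
  · exact h x hx

theorem linearIndependent_pair_iff_notMem_span {x y : V} :
    LinearIndependent K ![x, y] ↔ x ∉ K ∙ y ∧ y ≠ 0 := by
  simp only [Matrix.vecCons, linearIndependent_finCons]
  simp [and_comm]

theorem linearIndependent_triple_iff_notMem_span {x y z : V} :
    LinearIndependent K ![x, y, z] ↔ x ∉ span K {y, z} ∧ LinearIndependent K ![y, z] := by
  simp only [Matrix.vecCons, linearIndependent_finCons]
  simp [Set.pair_comm, and_comm]

theorem eq_of_linearIndependent_triple {x y z : V} (h : LinearIndependent K ![x, y, z])
    {a b c a' b' c' : K} (e : a • x + b • y + c • z = a' • x + b' • y + c' • z) :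
    a = a' ∧ b = b' ∧ c = c' := by
  have hcoeff : ![a, b, c] = ![a', b', c'] := by
    refine h.fintypeLinearCombination_injective ?_
    simpa [Fintype.linearCombination_apply, Fin.sum_univ_three] using e
  exact ⟨congrFun hcoeff 0, congrFun hcoeff 1, congrFun hcoeff 2⟩

theorem eq_of_mem_span_add_smul {u d v : V} (h : LinearIndependent K ![u, d]) (hv : v ≠ 0)
    {c c' : K} (hc : v ∈ K ∙ (u + c • d)) (hc' : v ∈ K ∙ (u + c' • d)) : c = c' := by
  obtain ⟨a, rfl⟩ := mem_span_singleton.1 hc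
  obtain ⟨a', e⟩ := mem_span_singleton.1 hc'
  obtain ⟨rfl, hac⟩ := h.eq_of_pair (by simpa only [smul_add, smul_smul] using e)
  exact (mul_left_cancel₀ (fun ha => hv (by rw [ha, zero_smul])) hac).symm

theorem exists_mem_span_add_smul {u d v : V} (hv : v ∈ span K {u, d}) (hd : v ∉ K ∙ d) :
    ∃ c : K, v ∈ K ∙ (u + c • d) := by
  obtain ⟨a, b, rfl⟩ := mem_span_pair.1 hv
  have ha : a ≠ 0 := fun ha => hd (mem_span_singleton.2 ⟨b, by rw [ha, zero_smul, zero_add]⟩)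
  exact ⟨a⁻¹ * b, mem_span_singleton.2 ⟨a, by rw [smul_add, smul_smul, mul_inv_cancel_left₀ ha]⟩⟩

variable (K) in
/-- The projective points represented by the values of `F` do not lie on a line. -/
def NoncollinearRange {ι : Type*} (F : ι → V) : Prop :=
  ∀ a b : V, ∃ i, F i ∉ span K {a, b}

namespace NoncollinearRange

variable {ι : Type*} {F : ι → V}

theorem of_linearIndependent {i j k : ι} (h : LinearIndependent K ![F i, F j, F k]) :
    NoncollinearRange K F := by
  intro a b
  by_contra! hab
  have hle : span K (Set.range ![F i, F j, F k]) ≤ span K {a, b} := by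
    simp [span_le, Set.insert_subset_iff, hab]
  have hfin : Module.Finite K (span K {a, b}) := Module.Finite.span_of_finite K (Set.toFinite _)
  classical
  have three_le : 3 ≤ Module.finrank K (span K {a, b}) := by
    simpa only [finrank_span_eq_card h, Fintype.card_fin] using finrank_mono hle
  have le_two : Module.finrank K (span K {a, b}) ≤ 2 :=
    (finrank_span_le_card _).trans (by simpa using Finset.card_le_two)
  omega

theorem linearIndependent (hF : NoncollinearRange K F) {x y z : V}
    (h : ∀ i, F i ∈ span K {x, y, z}) : LinearIndependent K ![x, y, z] := by
  have not_le (a b : V) : ¬ span K {x, y, z} ≤ span K {a, b} := fun hle =>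
    (hF a b).elim fun i hi => hi (hle (h i))
  simp only [span_le, Set.insert_subset_iff, Set.singleton_subset_iff, SetLike.mem_coe] at not_le
  have left (a b : V) : a ∈ span K {a, b} := subset_span (Set.mem_insert _ _)
  have right (a b : V) : b ∈ span K {a, b} := subset_span (Set.mem_insert_of_mem _ rfl)
  rw [linearIndependent_triple_iff_notMem_span, linearIndependent_pair_iff_notMem_span]
  exact ⟨fun hx => not_le y z ⟨hx, left y z, right y z⟩,
    fun hy => not_le x z ⟨left x z, span_mono (Set.subset_insert _ _) hy, right x z⟩,
    fun hz => not_le x y ⟨left x y, right x y, hz ▸ zero_mem _⟩⟩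

end NoncollinearRange

end LinearAlgebra

section Extension

theorem exists_addMonoidHom_eq_off_addSubgroup {G A : Type*} [AddCommGroup G] [AddCommGroup A]
    {N : AddSubgroup G} (hN : ∀ x y, ∃ z ∉ N, x + z ∉ N ∧ y + z ∉ N) {d : G → A}
    (hd : ∀ x y, x ∉ N → y ∉ N → x + y ∉ N → d (x + y) = d x + d y) :
    ∃ Φ : G →+ A, ∀ x ∉ N, Φ x = d x := by
  classical
  have add_notMem {x y : G} (hx : x ∈ N) (hy : y ∉ N) : x + y ∉ N := fun h =>
    hy ((add_mem_cancel_left hx).1 h)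
  obtain ⟨z₀, hz₀, -⟩ := hN 0 0
  let Φ (x : G) : A := if x ∈ N then d (x + z₀) - d z₀ else d x
  have increment_eq {x z w : G} (hx : x ∈ N) (hz : z ∉ N) (hw : w ∉ N) (hzw : z + w ∉ N) :
      d (x + z) - d z = d (x + w) - d w := by
    rw [sub_eq_sub_iff_add_eq_add, ← hd _ _ (add_notMem hx hz) hw, ← hd _ _ (add_notMem hx hw) hz,
      add_right_comm]
    · rw [add_assoc, add_comm w]; exact add_notMem hx hzw
    · rw [add_assoc]; exact add_notMem hx hzw
  have map_add_of_notMem {x z : G} (hz : z ∉ N) (hxz : x + z ∉ N) : d (x + z) = Φ x + d z := by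
    by_cases hx : x ∈ N
    · obtain ⟨w, hw, hzw, hz₀w⟩ := hN z z₀
      simp only [Φ, if_pos hx]
      rw [increment_eq hx hz₀ hw hz₀w, ← increment_eq hx hz hw hzw, sub_add_cancel]
    · simp only [Φ, if_neg hx, hd x z hx hz hxz]
  refine ⟨AddMonoidHom.mk' Φ fun x y => ?_, fun x hx => if_neg hx⟩
  obtain ⟨w, hw, hyw, hxyw⟩ := hN y (x + y)
  apply add_right_cancel (b := d w)
  rw [← map_add_of_notMem hw hxyw, add_assoc, map_add_of_notMem hyw (by rwa [← add_assoc]),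
    map_add_of_notMem hw hyw, add_assoc]

theorem exists_semilinearMap_eq_off_submodule {K V K' V' : Type*} [DivisionRing K]
    [AddCommGroup V] [Module K V] [Ring K'] [AddCommGroup V'] [Module K' V'] {σ : K →+* K'}
    {N : Submodule K V} (hN : ∀ x y, ∃ z ∉ N, x + z ∉ N ∧ y + z ∉ N) {d : V → V'}
    (hadd : ∀ x y, x ∉ N → y ∉ N → x + y ∉ N → d (x + y) = d x + d y)
    (hsmul : ∀ t : K, t ≠ 0 → ∀ x ∉ N, d (t • x) = σ t • d x) :
    ∃ Φ : V →ₛₗ[σ] V', ∀ x ∉ N, Φ x = d x := by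
  obtain ⟨Φ, hΦ⟩ := exists_addMonoidHom_eq_off_addSubgroup (N := N.toAddSubgroup) hN hadd
  have map_smul_of_notMem (t : K) {x : V} (hx : x ∉ N) : Φ (t • x) = σ t • Φ x := by
    rcases eq_or_ne t 0 with rfl | ht
    · simp only [zero_smul, map_zero]
    · rw [hΦ x hx, hΦ (t • x) (mt (N.smul_mem_iff ht).1 hx), hsmul t ht x hx]
  refine ⟨{ Φ with map_smul' := fun t x => ?_ }, hΦ⟩
  obtain ⟨z, hz, hxz, -⟩ := hN x x
  change Φ (t • x) = σ t • Φ x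
  rw [← add_sub_cancel_right x z, smul_sub, map_sub, map_sub, map_smul_of_notMem t hxz,
    map_smul_of_notMem t hz, smul_sub]

end Extension

section AffineLift

open Submodule AffineMap

variable {K K' U U₁ V' : Type*} [DivisionRing K] [AddCommGroup U] [Module K U]
  [AddCommGroup U₁] [Module K U₁] [DivisionRing K'] [AddCommGroup V'] [Module K' V']

variable (K K') in
/-- Representing vectors of the values of a morphism from the affine space `U` to the projective
space of `V'`: the points sent into a given projective subspace form an affine subspace. -/
structure IsAffineLift (g : U → V') : Prop where
  ne_zero : ∀ x, g x ≠ 0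
  exists_affineSubspace : ∀ W : Submodule K' V', ∃ A : AffineSubspace K U, ∀ x, x ∈ A ↔ g x ∈ W

namespace IsAffineLift

variable {g : U → V'} (hg : IsAffineLift K K' g)
include hg

theorem comp (φ : U₁ →ᵃ[K] U) : IsAffineLift K K' (g ∘ φ) where
  ne_zero x := hg.ne_zero (φ x)
  exists_affineSubspace W := by
    obtain ⟨A, hA⟩ := hg.exists_affineSubspace W
    exact ⟨A.comap φ, fun x => hA (φ x)⟩

theorem lineMap_mem {W : Submodule K' V'} {x y : U} (hx : g x ∈ W) (hy : g y ∈ W) (c : K) :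
    g (lineMap x y c) ∈ W := by
  obtain ⟨A, hA⟩ := hg.exists_affineSubspace W
  exact (hA _).1 (AffineMap.lineMap_mem c ((hA x).2 hx) ((hA y).2 hy))

end IsAffineLift

end AffineLift

section Plane

open Submodule AffineMap Cardinal

variable {K K' V' : Type*} [DivisionRing K] [DivisionRing K'] [AddCommGroup V'] [Module K' V']
  {G : K × K → V'}

theorem IsAffineLift.mem_of_column (hG : IsAffineLift K K' G) {W : Submodule K' V'} {t₀ t s : K}
    (h0 : G (t₀, 0) ∈ W) (h1 : G (t₀, 1) ∈ W) (ht : t ≠ t₀) (h : G (t, s) ∈ W) (p : K × K) :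
    G p ∈ W := by
  obtain ⟨A, hA⟩ := hG.exists_affineSubspace W
  rw [← hA] at *
  have hp : p - (t₀, 0) = ((p.1 - t₀) * (t - t₀)⁻¹) • ((t, s) - (t₀, 0)) +
      (p.2 - (p.1 - t₀) * (t - t₀)⁻¹ * s) • ((t₀, 1) - (t₀, 0)) := by
    ext <;> simp [inv_mul_cancel_right₀ (sub_ne_zero.2 ht)]
  have hdir : p - (t₀, 0) ∈ A.direction := hp ▸ add_mem
    (A.direction.smul_mem _ (AffineSubspace.vsub_mem_direction h h0))
    (A.direction.smul_mem _ (AffineSubspace.vsub_mem_direction h1 h0))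
  simpa using AffineSubspace.vadd_mem_of_mem_direction hdir h0

/-- Affine coordinates `τ` and `θ` for the images of the columns `t = 0` and `t = 1`, which lie on
two lines meeting in the point `⟨d⟩`. -/
structure IsColumnFrame (G : K × K → V') (e d : V') (τ θ : K → K') : Prop where
  linearIndependent : LinearIndependent K' ![G (0, 0), e, d]
  left : ∀ s, G (0, s) ∈ K' ∙ (G (0, 0) + τ s • d)
  right : ∀ s, G (1, s) ∈ K' ∙ (e + θ s • d)
  left_zero : τ 0 = 0
  left_one : τ 1 = 1
  right_zero : θ 0 = 0
  right_one : θ 1 = 1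

variable (hG : IsAffineLift K K' G)
include hG

section Noncollinear

variable (hnc : NoncollinearRange K' G)
include hnc

theorem notMem_span_pair_of_column (a c : V') {t₀ t : K} (h0 : G (t₀, 0) ∈ span K' {a, c})
    (h1 : G (t₀, 1) ∈ span K' {a, c}) (ht : t ≠ t₀) (s : K) : G (t, s) ∉ span K' {a, c} :=
  fun h => (hnc a c).elim fun p hp => hp (hG.mem_of_column h0 h1 ht h p)

theorem exists_ne_zero_smul_add_smul_add_smul_eq : ∃ α β γ : K', α ≠ 0 ∧ β ≠ 0 ∧ γ ≠ 0 ∧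
    α • G (0, 0) + β • G (1, 0) + γ • G (0, 1) = G (1, 1) := by
  obtain ⟨α, β, γ, h⟩ := mem_span_triple.1 (hG.mem_of_column (t₀ := 0) (t := 1) (s := 0)
    (W := span K' {G (0, 0), G (1, 0), G (0, 1)}) (subset_span (by simp))
    (subset_span (by simp)) one_ne_zero (subset_span (by simp)) (1, 1))
  refine ⟨α, β, γ, ?_, ?_, ?_, h⟩ <;> rintro rfl
  · exact notMem_span_pair_of_column hG hnc (G (1, 0)) (G (0, 1)) (subset_span (by simp))
      (mem_span_pair.2 ⟨β, γ, by simpa using h⟩) zero_ne_one 1 (subset_span (by simp))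
  · exact notMem_span_pair_of_column hG hnc (G (0, 0)) (G (0, 1)) (subset_span (by simp))
      (subset_span (by simp)) one_ne_zero 1 (mem_span_pair.2 ⟨α, γ, by simpa using h⟩)
  · exact notMem_span_pair_of_column hG hnc (G (0, 0)) (G (1, 0)) (subset_span (by simp))
      (mem_span_pair.2 ⟨α, β, by simpa using h⟩) zero_ne_one 0 (subset_span (by simp))

theorem exists_parallelogram : ∃ e d : V', LinearIndependent K' ![G (0, 0), e, d] ∧
    G (0, 1) ∈ K' ∙ (G (0, 0) + d) ∧ G (1, 0) ∈ K' ∙ e ∧ G (1, 1) ∈ K' ∙ (e + d) := by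
  obtain ⟨α, β, γ, hα, hβ, hγ, h⟩ := exists_ne_zero_smul_add_smul_add_smul_eq hG hnc
  have mem_span_smul {c : K'} (hc : c ≠ 0) (x : V') : x ∈ K' ∙ (c • x) := by
    rw [span_singleton_smul_eq hc.isUnit]
    exact mem_span_singleton_self x
  obtain ⟨e, he⟩ : ∃ e, e = (-(α⁻¹ * β)) • G (1, 0) := ⟨_, rfl⟩
  obtain ⟨d, hd⟩ : ∃ d, d = (-(α⁻¹ * γ)) • G (0, 1) - G (0, 0) := ⟨_, rfl⟩
  have hbd : G (0, 0) + d = (-(α⁻¹ * γ)) • G (0, 1) := by rw [hd, add_sub_cancel]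
  have hed : e + d = (-α⁻¹) • G (1, 1) := by
    simp only [he, hd, ← h, smul_add, smul_smul, neg_smul, neg_mul, inv_mul_cancel₀ hα, one_smul]
    abel
  have h01 : G (0, 1) ∈ K' ∙ (G (0, 0) + d) := hbd ▸ mem_span_smul (by simp [hα, hγ]) _
  have h10 : G (1, 0) ∈ K' ∙ e := he ▸ mem_span_smul (by simp [hα, hβ]) _
  have h11 : G (1, 1) ∈ K' ∙ (e + d) := hed ▸ mem_span_smul (by simp [hα]) _
  refine ⟨e, d, hnc.linearIndependent (hG.mem_of_column (t₀ := 0) (t := 1) (s := 0) ?_ ?_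
    one_ne_zero ?_), h01, h10, h11⟩
  · exact subset_span (by simp)
  · exact span_le.2 (by simpa using mem_span_triple.2 ⟨1, 0, 1, by simp⟩) h01
  · exact span_mono (by simp) h10

theorem exists_isColumnFrame : ∃ (e d : V') (τ θ : K → K'), IsColumnFrame G e d τ θ := by
  obtain ⟨e, d, hind, h01, h10, h11⟩ := exists_parallelogram hG hnc
  obtain ⟨hb, hed⟩ := linearIndependent_triple_iff_notMem_span.1 hind
  have hbd : LinearIndependent K' ![G (0, 0), d] :=
    linearIndependent_pair_iff_notMem_span.2 ⟨fun h => hb (span_mono (by simp) h), hed.ne_zero 1⟩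
  have add_mem_span (u c : V') : u + c ∈ span K' {u, c} := mem_span_pair.2 ⟨1, 1, by simp⟩
  have h00 : G (0, 0) ∈ span K' {G (0, 0), d} := subset_span (by simp)
  have h01' : G (0, 1) ∈ span K' {G (0, 0), d} :=
    span_le.2 (by simpa using add_mem_span _ _) h01
  have h10' : G (1, 0) ∈ span K' {e, d} := span_mono (by simp) h10
  have h11' : G (1, 1) ∈ span K' {e, d} :=
    span_le.2 (by simpa using add_mem_span _ _) h11
  have hτ (s : K) : ∃ c : K', G (0, s) ∈ K' ∙ (G (0, 0) + c • d) := by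
    have mem := hG.lineMap_mem h00 h01' s
    refine exists_mem_span_add_smul (by simpa [lineMap_apply] using mem) fun h => ?_
    exact notMem_span_pair_of_column hG hnc e d h10' h11' zero_ne_one s (span_mono (by simp) h)
  have hθ (s : K) : ∃ c : K', G (1, s) ∈ K' ∙ (e + c • d) := by
    have mem := hG.lineMap_mem h10' h11' s
    refine exists_mem_span_add_smul (by simpa [lineMap_apply] using mem) fun h => ?_
    exact notMem_span_pair_of_column hG hnc _ d h00 h01' one_ne_zero s (span_mono (by simp) h)
  choose τ hτ using hτ
  choose θ hθ using hθ
  exact ⟨e, d, τ, θ, hind, hτ, hθ,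
    eq_of_mem_span_add_smul hbd (hG.ne_zero _) (hτ 0) (by simp),
    eq_of_mem_span_add_smul hbd (hG.ne_zero _) (hτ 1) (by simpa using h01),
    eq_of_mem_span_add_smul hed (hG.ne_zero _) (hθ 0) (by simpa using h10),
    eq_of_mem_span_add_smul hed (hG.ne_zero _) (hθ 1) (by simpa using h11)⟩

end Noncollinear

namespace IsColumnFrame

variable {e d : V'} {τ θ : K → K'} (hF : IsColumnFrame G e d τ θ)
include hF

theorem exists_coeffs (t s : K) : ∃ α β : K', ∀ z z', (1 - t) * z + t * z' = s →
    α • G (0, 0) + β • e + (α * τ z + β * θ z') • d = G (t, s) := by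
  have exists_of_mem_line (z z' : K) (h : (1 - t) * z + t * z' = s) : ∃ α β : K',
      α • G (0, 0) + β • e + (α * τ z + β * θ z') • d = G (t, s) := by
    -- `(t, s)` lies on the line joining `(0, z)` to `(1, z')`.
    have hline := hG.lineMap_mem (W := span K' {G (0, 0) + τ z • d, e + θ z' • d})
      (span_mono (by simp) (hF.left z)) (span_mono (by simp) (hF.right z')) t
    have : lineMap ((0 : K), z) (1, z') t = (t, s) := by
      ext
      · simp [lineMap_apply]
      · rw [snd_lineMap, lineMap_apply_module', ← h, smul_eq_mul]
        noncomm_ring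
    rw [this] at hline
    obtain ⟨α, β, hαβ⟩ := mem_span_pair.1 hline
    refine ⟨α, β, hαβ ▸ ?_⟩
    simp only [smul_add, add_smul, mul_smul]
    abel
  obtain ⟨α, β, h⟩ := exists_of_mem_line s s (by rw [← add_mul, sub_add_cancel, one_mul])
  refine ⟨α, β, fun z z' hz => ?_⟩
  obtain ⟨α', β', h'⟩ := exists_of_mem_line z z' hz
  obtain ⟨rfl, rfl, -⟩ := eq_of_linearIndependent_triple hF.linearIndependent (h'.trans h.symm)
  exact h'

-- The projection of one column onto the other from a point with first coordinate `(1 - n)⁻¹` is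
-- `z ↦ r + n * z`.
theorem affine_relation {n : K} (hn0 : n ≠ 0) (hn1 : n ≠ 1) (r : K) :
    ∃ c β : K', ∀ z, τ z = c + β * θ (r + n * z) := by
  obtain ⟨t, ht⟩ : ∃ t, t = (1 - n)⁻¹ := ⟨_, rfl⟩
  have htn : t * (1 - n) = 1 := ht ▸ inv_mul_cancel₀ (sub_ne_zero.2 hn1.symm)
  obtain ⟨α, β, h⟩ := hF.exists_coeffs hG t (t * r)
  have mem_line (z : K) : (1 - t) * z + t * (r + n * z) = t * r := by
    calc _ = t * r + z - (t * (1 - n)) * z := by noncomm_ring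
      _ = _ := by rw [htn, one_mul, add_sub_cancel_right]
  have right_mem (s : K) : G (1, s) ∈ span K' {e, d} :=
    span_le.2 (by simpa using mem_span_pair.2 ⟨1, θ s, by simp⟩) (hF.right s)
  have hα : α ≠ 0 := by
    rintro rfl
    have ht1 : t ≠ 1 := by simpa [ht] using hn0
    have mem : G (t, t * r) ∈ span K' {e, d} :=
      mem_span_pair.2 ⟨β, _, by simpa using h _ _ (mem_line 0)⟩
    exact (linearIndependent_triple_iff_notMem_span.1 hF.linearIndependent).1
      (hG.mem_of_column (right_mem 0) (right_mem 1) ht1 mem (0, 0))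
  refine ⟨α⁻¹ * (β * θ r), -(α⁻¹ * β), fun z => ?_⟩
  have hz := (eq_of_linearIndependent_triple hF.linearIndependent
    ((h _ _ (mem_line z)).trans (h _ _ (mem_line 0)).symm)).2.2
  rw [hF.left_zero, mul_zero, zero_add, mul_zero, add_zero] at hz
  rw [← hz, mul_add, inv_mul_cancel_left₀ hα, ← mul_assoc, neg_mul, add_neg_cancel_right]

theorem exists_semiaffine (hK : 4 ≤ #K ∨ (#K = 3 ∧ CharP K' 3)) :
    ∃ (σ : K →+* K') (d₁ d₂ : V'), ∀ t s,
      G (t, s) ∈ K' ∙ (G (0, 0) + σ t • d₁ + σ s • d₂) := by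
  obtain ⟨σ, hτ, hθ⟩ := exists_ringHom_of_affine_relation hK hF.left_zero hF.left_one
    hF.right_zero hF.right_one fun n hn0 hn1 => hF.affine_relation hG hn0 hn1
  refine ⟨σ, e - G (0, 0), d, fun t s => ?_⟩
  obtain ⟨α, β, h⟩ := hF.exists_coeffs hG t s
  have h₁ := h s s (by noncomm_ring)
  have h₂ := h (s + t) (s - (1 - t)) (by noncomm_ring)
  have hα : (α + β) * σ t = β := by
    have := (eq_of_linearIndependent_triple hF.linearIndependent (h₁.trans h₂.symm)).2.2
    simp only [hτ, hθ, map_add, map_sub, map_one] at this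
    rw [← sub_eq_zero] at this ⊢
    rw [← neg_zero, ← this]
    noncomm_ring
  refine mem_span_singleton.2 ⟨α + β, ?_⟩
  rw [← h₁, smul_add, smul_add, smul_smul, hα, hτ, hθ, ← add_mul, mul_smul, smul_sub, add_smul]
  abel

end IsColumnFrame

end Plane

section Gluing

open Submodule Cardinal

theorem three_le_card {α : Type*} {p : Prop} (h : 4 ≤ #α ∨ (#α = 3 ∧ p)) : 3 ≤ #α :=
  h.elim (le_trans (by norm_num)) fun h => h.1.ge

theorem eq_zero_and_eq_of_map_add_eq_mul_map {K K' : Type*} [DivisionRing K] [DivisionRing K']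
    (hK : 3 ≤ #K) {σ σ' : K →+* K'} {c : K'} (h : ∀ s ≠ 0, σ' s + c = (c + 1) * σ s) :
    c = 0 ∧ σ = σ' := by
  obtain ⟨r, hr0, hr1⟩ := exists_ne_ne_of_three_le hK 0 (-1)
  have hc : c = 0 := by
    have hsum := h (1 + r) fun e => hr1 (eq_neg_of_add_eq_zero_right e)
    rw [map_add, map_add, mul_add, ← h 1 one_ne_zero, ← h r hr0] at hsum
    rwa [add_add_add_comm, add_right_inj, left_eq_add] at hsum
  refine ⟨hc, RingHom.ext fun s => ?_⟩
  rcases eq_or_ne s 0 with rfl | hs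
  · rw [map_zero, map_zero]
  · simpa only [hc, add_zero, zero_add, one_mul] using (h s hs).symm

variable {K K' U V' : Type*} [DivisionRing K] [AddCommGroup U] [Module K U]
  [DivisionRing K'] [AddCommGroup V'] [Module K' V'] {g : U → V'}

/-- On the line through `0` and `x` the map `t • x ↦ ⟨g (t • x)⟩` is semiaffine: it is induced by
`t • x ↦ g 0 + σ t • d`. -/
def IsSemiaffineAlong (g : U → V') (σ : K →+* K') (x : U) (d : V') : Prop :=
  ∀ t : K, g (t • x) ∈ K' ∙ (g 0 + σ t • d)

theorem IsSemiaffineAlong.mem {σ : K →+* K'} {x : U} {d : V'} (h : IsSemiaffineAlong g σ x d) :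
    g x ∈ K' ∙ (g 0 + d) := by
  simpa using h 1

namespace IsAffineLift

variable (hg : IsAffineLift K K' g)

/-- The points whose image is on the line joining the images of `0` and `x`; for `x = 0` this line
degenerates to the image of `0`. -/
def linePreimage (x : U) : Submodule K U where
  carrier := {u | g u ∈ span K' {g 0, g x}}
  zero_mem' := subset_span (by simp)
  add_mem' {u v} hu hv := by
    obtain ⟨A, hA⟩ := hg.exists_affineSubspace (span K' {g 0, g x})
    have h0 : (0 : U) ∈ A := (hA 0).2 (subset_span (by simp))
    have hdir : u ∈ A.direction := by
      simpa using AffineSubspace.vsub_mem_direction ((hA u).2 hu) h0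
    exact (hA _).1 (AffineSubspace.vadd_mem_of_mem_direction hdir ((hA v).2 hv))
  smul_mem' a u hu := by
    simpa [AffineMap.lineMap_apply] using
      hg.lineMap_mem (x := 0) (subset_span (by simp)) hu a

theorem mem_linePreimage {u x : U} : u ∈ hg.linePreimage x ↔ g u ∈ span K' {g 0, g x} := Iff.rfl

theorem mem_linePreimage_zero {u : U} : u ∈ hg.linePreimage 0 ↔ g u ∈ K' ∙ g 0 := by
  rw [mem_linePreimage, Set.pair_eq_singleton]

theorem self_mem_linePreimage (x : U) : x ∈ hg.linePreimage x := subset_span (by simp)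

theorem linePreimage_mono {u x : U} (h : u ∈ hg.linePreimage x) :
    hg.linePreimage u ≤ hg.linePreimage x := fun w hw => by
  have hle : span K' {g 0, g u} ≤ span K' {g 0, g x} :=
    span_le.2 (Set.pair_subset (subset_span (by simp)) h)
  exact hle hw

theorem linePreimage_zero_le (x : U) : hg.linePreimage 0 ≤ hg.linePreimage x :=
  hg.linePreimage_mono (zero_mem _)

theorem notMem_linePreimage_zero {x y : U} (hy : y ∉ hg.linePreimage x) :
    y ∉ hg.linePreimage 0 :=
  fun h => hy (hg.linePreimage_zero_le x h)

theorem mem_linePreimage_symm {u x : U} (h : u ∈ hg.linePreimage x) (hu : u ∉ hg.linePreimage 0) :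
    x ∈ hg.linePreimage u := by
  rw [mem_linePreimage, Set.pair_comm] at h ⊢
  rw [mem_linePreimage_zero] at hu
  exact mem_span_insert_exchange h hu

theorem exists_notMem_linePreimage (hnc : NoncollinearRange K' g) (x : U) :
    ∃ y, y ∉ hg.linePreimage x :=
  hnc (g 0) (g x)

theorem exists_add_notMem_linePreimage_zero (hK : 3 ≤ #K) (hnc : NoncollinearRange K' g)
    (x y : U) : ∃ z ∉ hg.linePreimage 0,
      x + z ∉ hg.linePreimage 0 ∧ y + z ∉ hg.linePreimage 0 := by
  obtain ⟨w, hw⟩ := hg.exists_notMem_linePreimage hnc x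
  have smul_notMem {k : K} (hk : k ≠ 0) : k • w ∉ hg.linePreimage x :=
    mt (smul_mem_iff _ hk).1 hw
  have add_notMem {k : K} (hk : k ≠ 0) : x + k • w ∉ hg.linePreimage x := fun h =>
    smul_notMem hk ((add_mem_cancel_left (hg.self_mem_linePreimage x)).1 h)
  obtain ⟨k, hk, hyk⟩ : ∃ k : K, k ≠ 0 ∧ y + k • w ∉ hg.linePreimage 0 := by
    by_contra! h
    obtain ⟨r, hr0, hr1⟩ := exists_ne_ne_of_three_le hK (0 : K) 1
    have hsub := sub_mem (h r hr0) (h 1 one_ne_zero)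
    rw [add_sub_add_left_eq_sub, ← sub_smul] at hsub
    exact smul_notMem (sub_ne_zero.2 hr1) (hg.linePreimage_zero_le x hsub)
  exact ⟨k • w, hg.notMem_linePreimage_zero (smul_notMem hk),
    hg.notMem_linePreimage_zero (add_notMem hk), hyk⟩

include hg

theorem linearIndependent_direction {σ : K →+* K'} {x : U} {d : V'} (hx : x ∉ hg.linePreimage 0)
    (h : IsSemiaffineAlong g σ x d) : LinearIndependent K' ![d, g 0] := by
  refine linearIndependent_pair_iff_notMem_span.2 ⟨fun hd => ?_, hg.ne_zero 0⟩
  exact hx (hg.mem_linePreimage_zero.2 ((span_singleton_le_iff_mem _ _).2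
    (add_mem (mem_span_singleton_self _) hd) h.mem))

theorem ringHom_eq_and_direction_eq (hK : 3 ≤ #K) {σ σ' : K →+* K'} {x : U} {d d' : V'}
    (hx : x ∉ hg.linePreimage 0) (h : IsSemiaffineAlong g σ x d)
    (h' : IsSemiaffineAlong g σ' x d') : σ = σ' ∧ d = d' := by
  have hind := hg.linearIndependent_direction hx h
  have scalar_ne_zero {k : K'} {y : U} {v : V'} (e : k • v = g y) : k ≠ 0 := fun hk =>
    hg.ne_zero y (by rw [← e, hk, zero_smul])
  obtain ⟨c, hd'⟩ : ∃ c : K', d' = (c + 1) • d + c • g 0 := by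
    obtain ⟨k, hk⟩ := mem_span_singleton.1 h.mem
    obtain ⟨k', hk'⟩ := mem_span_singleton.1 h'.mem
    have e : g 0 + d' = (k'⁻¹ * k) • (g 0 + d) := by
      rw [mul_smul, hk, ← hk', inv_smul_smul₀ (scalar_ne_zero hk')]
    refine ⟨k'⁻¹ * k - 1, ?_⟩
    rw [eq_sub_of_add_eq' e, sub_add_cancel, sub_smul, one_smul, smul_add]
    abel
  have relation (s : K) (hs : s ≠ 0) : σ' s + c = (c + 1) * σ s := by
    obtain ⟨k, hk⟩ := mem_span_singleton.1 (h s⁻¹)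
    obtain ⟨k', hk'⟩ := mem_span_singleton.1 (h' s⁻¹)
    have hs' : σ' s⁻¹ ≠ 0 := (map_ne_zero σ').2 (inv_ne_zero hs)
    obtain ⟨e₁, e₂⟩ := hind.eq_of_pair (s := k * σ s⁻¹) (t := k)
      (s' := k' * (σ' s⁻¹ * (c + 1))) (t' := k' * (1 + σ' s⁻¹ * c)) (by
        rw [← hk', hd'] at hk
        simp only [smul_add, smul_smul, add_smul, mul_add, mul_one] at hk ⊢
        rw [add_comm, hk]
        abel)
    rw [e₂, mul_assoc, map_inv₀ σ] at e₁
    have e := mul_left_cancel₀ (scalar_ne_zero hk') e₁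
    rw [mul_inv_eq_iff_eq_mul₀ ((map_ne_zero σ).2 hs), mul_assoc] at e
    refine mul_left_cancel₀ hs' (Eq.trans ?_ e)
    rw [mul_add, ← map_mul, inv_mul_cancel₀ hs, map_one]
  obtain ⟨rfl, hσ⟩ := eq_zero_and_eq_of_map_add_eq_mul_map hK relation
  exact ⟨hσ, by rw [hd', zero_add, one_smul, zero_smul, add_zero]⟩

theorem noncollinearRange_plane {x y : U} (hx : x ∉ hg.linePreimage 0)
    (hy : y ∉ hg.linePreimage x) :
    NoncollinearRange K' fun p : K × K => g (p.1 • x + p.2 • y) := by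
  refine .of_linearIndependent (i := (0, 1)) (j := (1, 0)) (k := (0, 0)) ?_
  simp only [zero_smul, one_smul, add_zero, zero_add]
  exact linearIndependent_triple_iff_notMem_span.2 ⟨fun h => hy (by rwa [Set.pair_comm] at h),
    linearIndependent_pair_iff_notMem_span.2
      ⟨fun h => hx (hg.mem_linePreimage_zero.2 h), hg.ne_zero 0⟩⟩

variable (hK : 4 ≤ #K ∨ (#K = 3 ∧ CharP K' 3))
include hK

theorem exists_semiaffine_plane {x y : U} (hx : x ∉ hg.linePreimage 0)
    (hy : y ∉ hg.linePreimage x) : ∃ (σ : K →+* K') (d₁ d₂ : V'), ∀ t s : K,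
      IsSemiaffineAlong g σ (t • x + s • y) (σ t • d₁ + σ s • d₂) := by
  let φ : K × K →ᵃ[K] U :=
    ((LinearMap.toSpanSingleton K U x).coprod (LinearMap.toSpanSingleton K U y)).toAffineMap
  have hG : IsAffineLift K K' fun p : K × K => g (p.1 • x + p.2 • y) := hg.comp φ
  obtain ⟨e, d, τ, θ, hF⟩ := exists_isColumnFrame hG (hg.noncollinearRange_plane hx hy)
  obtain ⟨σ, d₁, d₂, h⟩ := hF.exists_semiaffine hG hK
  refine ⟨σ, d₁, d₂, fun t s k => ?_⟩
  simpa [smul_add, smul_smul, add_assoc] using h (k * t) (k * s)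

variable (hnc : NoncollinearRange K' g)
include hnc

theorem exists_ringHom_forall_isSemiaffineAlong :
    ∃ σ : K →+* K', ∀ x ∉ hg.linePreimage 0, ∃ d, IsSemiaffineAlong g σ x d := by
  have hK3 := three_le_card hK
  have transfer {x y : U} (hx : x ∉ hg.linePreimage 0) (hy : y ∉ hg.linePreimage x)
      {σ : K →+* K'} {d : V'} (hd : IsSemiaffineAlong g σ x d) :
      ∃ d', IsSemiaffineAlong g σ y d' := by
    obtain ⟨σ', d₁, d₂, h⟩ := hg.exists_semiaffine_plane hK hx hy
    obtain ⟨rfl, -⟩ := hg.ringHom_eq_and_direction_eq hK3 hx hd (by simpa using h 1 0)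
    exact ⟨d₂, by simpa using h 0 1⟩
  obtain ⟨x₀, hx₀⟩ := hg.exists_notMem_linePreimage hnc 0
  obtain ⟨y₀, hy₀⟩ := hg.exists_notMem_linePreimage hnc x₀
  obtain ⟨σ, d₁, d₂, h⟩ := hg.exists_semiaffine_plane hK hx₀ hy₀
  refine ⟨σ, fun x hx => ?_⟩
  by_cases hxx₀ : x ∈ hg.linePreimage x₀
  · refine transfer (x := y₀) (d := d₂) (hg.notMem_linePreimage_zero hy₀) (fun hxy => hy₀ ?_)
      (by simpa using h 0 1)
    exact hg.linePreimage_mono hxx₀ (hg.mem_linePreimage_symm hxy hx)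
  · exact transfer (d := d₁) hx₀ hxx₀ (by simpa using h 1 0)

section Direction

variable {σ : K →+* K'} {d : U → V'} (hd : ∀ x ∉ hg.linePreimage 0, IsSemiaffineAlong g σ x (d x))
include hd

omit hnc in
theorem direction_smul_add_smul {x y : U} (hx : x ∉ hg.linePreimage 0)
    (hy : y ∉ hg.linePreimage x) {t s : K} (hts : t • x + s • y ∉ hg.linePreimage 0) :
    d (t • x + s • y) = σ t • d x + σ s • d y := by
  have hK3 := three_le_card hK
  obtain ⟨σ', d₁, d₂, h⟩ := hg.exists_semiaffine_plane hK hx hy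
  obtain ⟨rfl, rfl⟩ := hg.ringHom_eq_and_direction_eq hK3 hx (hd x hx) (by simpa using h 1 0)
  have hy0 := hg.notMem_linePreimage_zero hy
  obtain ⟨-, rfl⟩ := hg.ringHom_eq_and_direction_eq hK3 hy0 (hd y hy0) (by simpa using h 0 1)
  exact (hg.ringHom_eq_and_direction_eq hK3 hts (hd _ hts) (h t s)).2

theorem direction_smul {t : K} (ht : t ≠ 0) {x : U} (hx : x ∉ hg.linePreimage 0) :
    d (t • x) = σ t • d x := by
  obtain ⟨y, hy⟩ := hg.exists_notMem_linePreimage hnc x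
  simpa using hg.direction_smul_add_smul hK hd hx hy (t := t) (s := 0)
    (by simpa using mt (smul_mem_iff _ ht).1 hx)

theorem direction_add {x y : U} (hx : x ∉ hg.linePreimage 0) (hy : y ∉ hg.linePreimage 0)
    (hxy : x + y ∉ hg.linePreimage 0) : d (x + y) = d x + d y := by
  have add_of_notMem {x y : U} (hx : x ∉ hg.linePreimage 0) (hy : y ∉ hg.linePreimage x) :
      d (x + y) = d x + d y := by
    have hxy : x + y ∉ hg.linePreimage 0 := fun h => hy
      ((add_mem_cancel_left (hg.self_mem_linePreimage x)).1 (hg.linePreimage_zero_le x h))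
    simpa using hg.direction_smul_add_smul hK hd hx hy (t := 1) (s := 1) (by simpa using hxy)
  by_cases hyx : y ∈ hg.linePreimage x
  · obtain ⟨z, hz⟩ := hg.exists_notMem_linePreimage hnc x
    have hle := hg.linePreimage_mono (add_mem (hg.self_mem_linePreimage x) hyx)
    apply add_right_cancel (b := d z)
    rw [← add_of_notMem hxy fun h => hz (hle h), add_assoc, add_assoc,
      ← add_of_notMem hy fun h => hz (hg.linePreimage_mono hyx h),
      ← add_of_notMem hx fun h => hz ((add_mem_cancel_left hyx).1 h)]
  · exact add_of_notMem hx hyx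

end Direction

theorem exists_semilinear_forall_isSemiaffineAlong : ∃ (σ : K →+* K') (Φ : U →ₛₗ[σ] V'),
    ∀ x ∉ hg.linePreimage 0, IsSemiaffineAlong g σ x (Φ x) := by
  obtain ⟨σ, hσ⟩ := hg.exists_ringHom_forall_isSemiaffineAlong hK hnc
  choose! d hd using hσ
  obtain ⟨Φ, hΦ⟩ := exists_semilinearMap_eq_off_submodule
    (hg.exists_add_notMem_linePreimage_zero (three_le_card hK) hnc)
    (fun _ _ => hg.direction_add hK hnc hd)
    (fun _ ht _ => hg.direction_smul hK hnc hd ht)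
  exact ⟨σ, Φ, fun x hx => hΦ x hx ▸ hd x hx⟩

omit hK in
theorem mem_span_add_of_mem_linePreimage_zero (hK3 : 3 ≤ #K) {σ : K →+* K'} {Φ : U →ₛₗ[σ] V'}
    (hΦ : ∀ x ∉ hg.linePreimage 0, g x ∈ K' ∙ (g 0 + Φ x)) {x : U}
    (hx : x ∈ hg.linePreimage 0) : g x ∈ K' ∙ (g 0 + Φ x) := by
  obtain ⟨z, hz⟩ := hnc (g 0 + Φ x) (g 0)
  have hz0 : z ∉ hg.linePreimage 0 := fun h =>
    hz (span_mono (by simp) (hg.mem_linePreimage_zero.1 h))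
  obtain ⟨r, hr0, hr1⟩ := exists_ne_ne_of_three_le hK3 (0 : K) 1
  have line_mem (k : K) (hk : k ≠ 0) : g (x + k • z) ∈ span K' {Φ z, g 0 + Φ x} := by
    have hxk : x + k • z ∉ hg.linePreimage 0 := fun h =>
      hz0 ((smul_mem_iff _ hk).1 ((add_mem_cancel_left hx).1 h))
    refine (span_singleton_le_iff_mem _ _).2 ?_ (hΦ _ hxk)
    exact mem_span_pair.2 ⟨σ k, 1, by rw [map_add, LinearMap.map_smulₛₗ, one_smul]; abel⟩
  have hmem : g x ∈ span K' {Φ z, g 0 + Φ x} := by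
    have h := hg.lineMap_mem (line_mem 1 one_ne_zero) (line_mem r hr0) (-(r - 1)⁻¹)
    convert h using 2
    rw [AffineMap.lineMap_apply, vsub_eq_sub, add_sub_add_left_eq_sub, ← sub_smul, smul_smul,
      neg_mul, inv_mul_cancel₀ (sub_ne_zero.2 hr1), vadd_eq_add, one_smul, neg_one_smul,
      neg_add_cancel_comm_assoc]
  by_contra hgx
  have hΦz : Φ z ∈ span K' {g x, g 0 + Φ x} := mem_span_insert_exchange hmem hgx
  have hle : span K' {g x, g 0 + Φ x} ≤ span K' {g 0 + Φ x, g 0} :=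
    span_le.2 (Set.pair_subset (span_mono (by simp) (hg.mem_linePreimage_zero.1 hx))
      (subset_span (by simp)))
  exact hz ((span_singleton_le_iff_mem _ _).2
    (add_mem (subset_span (by simp)) (hle hΦz)) (hΦ z hz0))

theorem exists_semilinear : ∃ (σ : K →+* K') (Φ : U →ₛₗ[σ] V'), ∀ x, g x ∈ K' ∙ (g 0 + Φ x) := by
  obtain ⟨σ, Φ, hΦ⟩ := hg.exists_semilinear_forall_isSemiaffineAlong hK hnc
  refine ⟨σ, Φ, fun x => ?_⟩
  by_cases hx : x ∈ hg.linePreimage 0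
  · exact hg.mem_span_add_of_mem_linePreimage_zero hnc (three_le_card hK)
      (fun x hx => (hΦ x hx).mem) hx
  · exact (hΦ x hx).mem

omit hK in
theorem ringHom_eq_and_forall_eq (hK3 : 3 ≤ #K) {σ σ' : K →+* K'} {Φ : U →ₛₗ[σ] V'}
    {Ψ : U →ₛₗ[σ'] V'} (hΦ : ∀ x, g x ∈ K' ∙ (g 0 + Φ x)) (hΨ : ∀ x, g x ∈ K' ∙ (g 0 + Ψ x)) :
    σ = σ' ∧ ∀ x, Φ x = Ψ x := by
  have eq_of_notMem (x : U) (hx : x ∉ hg.linePreimage 0) : σ = σ' ∧ Φ x = Ψ x :=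
    hg.ringHom_eq_and_direction_eq hK3 hx (fun t => by simpa using hΦ (t • x))
      fun t => by simpa using hΨ (t • x)
  obtain ⟨z, hz⟩ := hg.exists_notMem_linePreimage hnc 0
  obtain ⟨rfl, -⟩ := eq_of_notMem z hz
  have htop := eq_top_of_forall_notMem_mem (M := LinearMap.eqLocus Φ Ψ)
    (fun h => hz (by rw [h]; exact mem_top)) fun x hx => (eq_of_notMem x hx).2
  exact ⟨rfl, fun x => LinearMap.congr_fun (LinearMap.eqLocus_eq_top.1 htop) x⟩

end IsAffineLift

end Gluing

section AffinoProjectiveLift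

open Submodule Cardinal

variable {K K' V V' : Type*} [DivisionRing K] [AddCommGroup V] [Module K V]
  [DivisionRing K'] [AddCommGroup V'] [Module K' V']

section LinearForm

variable {l : V →ₗ[K] K} {v₀ : V}

theorem exists_eq_smul_add_of_apply_ne_zero {v : V} (hv₀ : l v₀ = 1) (hv : l v ≠ 0) :
    ∃ u : LinearMap.ker l, v = l v • (v₀ + u) := by
  refine ⟨⟨(l v)⁻¹ • v - v₀, ?_⟩, by rw [add_sub_cancel, smul_inv_smul₀ hv]⟩
  rw [LinearMap.mem_ker, map_sub, map_smul, hv₀, smul_eq_mul, inv_mul_cancel₀ hv, sub_self]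

theorem linearForm_ne_zero (hv₀ : l v₀ = 1) : l ≠ 0 := by
  rintro rfl
  exact zero_ne_one hv₀

theorem linearForm_apply_add (hv₀ : l v₀ = 1) (u : LinearMap.ker l) : l (v₀ + u) = 1 := by
  rw [map_add, hv₀, LinearMap.mem_ker.1 u.2, add_zero]

theorem linearForm_apply_add_ne_zero (hv₀ : l v₀ = 1) (u : LinearMap.ker l) :
    l (v₀ + u) ≠ 0 := by
  rw [linearForm_apply_add hv₀]
  exact one_ne_zero

theorem exists_semilinear_extension (hv₀ : l v₀ = 1) {σ : K →+* K'} (w : V')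
    (Φ₀ : LinearMap.ker l →ₛₗ[σ] V') :
    ∃ Φ : V →ₛₗ[σ] V', ∀ u : LinearMap.ker l, Φ (v₀ + u) = w + Φ₀ u := by
  let π : V →ₗ[K] LinearMap.ker l :=
    (LinearMap.id - l.smulRight v₀).codRestrict (LinearMap.ker l) fun v => by simp [hv₀]
  refine ⟨(LinearMap.toSpanSingleton K' V' w).comp (σ.toSemilinearMap.comp l) + Φ₀.comp π,
    fun u => ?_⟩
  have hl : l (v₀ + u) = 1 := linearForm_apply_add hv₀ u
  have hπ : π (v₀ + u) = u := Subtype.ext (by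
    change (v₀ + u : V) - l (v₀ + u) • v₀ = u
    rw [hl, one_smul, add_sub_cancel_left])
  simp [hl, hπ, -map_add]

end LinearForm

theorem exists_semilinear_apply_eq {σ : K →+* K'} (Φ : V →ₛₗ[σ] V') {v₀ : V} {w : V'}
    (hw : w ≠ 0) (h : w ∈ K' ∙ Φ v₀) : ∃ (τ : K →+* K') (Ψ : V →ₛₗ[τ] V'),
      Ψ v₀ = w ∧ ∀ v, (K' ∙ Ψ v) = K' ∙ Φ v := by
  obtain ⟨c, rfl⟩ := mem_span_singleton.1 h
  have hc : c ≠ 0 := fun hc => hw (by rw [hc, zero_smul])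
  let conj : K' →+* K' := {
    toFun := fun s => c * s * c⁻¹
    map_one' := by simp [hc]
    map_zero' := by simp
    map_add' := by simp [mul_add, add_mul]
    map_mul' := by simp [mul_assoc, hc] }
  let Ψ : V →ₛₗ[conj.comp σ] V' := {
    toFun := fun v => c • Φ v
    map_add' := by simp
    map_smul' := by simp [conj, smul_smul, mul_assoc, hc] }
  exact ⟨_, Ψ, rfl, fun v => span_singleton_smul_eq hc.isUnit (Φ v)⟩

variable (K') in
/-- Representing vectors of the values of a morphism to the projective space of `V'` defined on a
set of points containing the complement of the hyperplane `l = 0`; the value `0` is assigned to the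
vectors spanning no point of this set. -/
structure IsAffinoProjectiveLift (l : V →ₗ[K] K) (F : V → V') : Prop where
  ne_zero : ∀ v, l v ≠ 0 → F v ≠ 0
  exists_submodule : ∀ W : Submodule K' V', ∃ M : Submodule K V, ∀ v, F v ≠ 0 → (F v ∈ W ↔ v ∈ M)

namespace IsAffinoProjectiveLift

variable {l : V →ₗ[K] K} {v₀ : V} {F : V → V'} (hF : IsAffinoProjectiveLift K' l F)
include hF

theorem smul_mem_iff {W : Submodule K' V'} {c : K} {v : V} (hc : c ≠ 0) (hv : l v ≠ 0) :
    F (c • v) ∈ W ↔ F v ∈ W := by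
  obtain ⟨M, hM⟩ := hF.exists_submodule W
  have hcv : l (c • v) ≠ 0 := by simp [hc, hv]
  rw [hM _ (hF.ne_zero _ hcv), hM _ (hF.ne_zero _ hv), M.smul_mem_iff hc]

theorem exists_notMem_span (hl : l ≠ 0) (hnc : NoncollinearRange K' F) (a b : V') :
    ∃ v, l v ≠ 0 ∧ F v ∉ span K' {a, b} := by
  by_contra! h
  obtain ⟨M, hM⟩ := hF.exists_submodule (span K' {a, b})
  have htop : M = ⊤ := eq_top_of_forall_notMem_mem (mt LinearMap.ker_eq_top.1 hl) fun v hv =>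
    (hM v (hF.ne_zero v hv)).1 (h v hv)
  obtain ⟨v, hv⟩ := hnc a b
  exact hv ((hM v fun h0 => hv (h0 ▸ zero_mem _)).2 (htop ▸ mem_top))

theorem mem_span_of_forall_apply_ne_zero (hl : l ≠ 0) (hnc : NoncollinearRange K' F)
    {σ : K →+* K'} {Φ : V →ₛₗ[σ] V'} (hΦ : ∀ v, l v ≠ 0 → F v ∈ K' ∙ Φ v) (v : V) :
    F v ∈ K' ∙ Φ v := by
  by_cases hv : l v = 0
  swap
  · exact hΦ v hv
  rcases eq_or_ne (F v) 0 with h0 | h0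
  · exact h0 ▸ zero_mem _
  obtain ⟨p, hlp, hp⟩ := hF.exists_notMem_span hl hnc (F v) (Φ v)
  obtain ⟨M, hM⟩ := hF.exists_submodule (span K' {Φ p, Φ v})
  have mem_of_mem {x : V} (hx : l x ≠ 0) (hΦx : Φ x ∈ span K' {Φ p, Φ v}) : x ∈ M :=
    (hM x (hF.ne_zero x hx)).1 ((span_singleton_le_iff_mem _ _).2 hΦx (hΦ x hx))
  have hpM : p ∈ M := mem_of_mem hlp (subset_span (by simp))
  have hpvM : p + v ∈ M := mem_of_mem (by simpa [hv]) (mem_span_pair.2 ⟨1, 1, by simp⟩)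
  have hFv : F v ∈ span K' {Φ p, Φ v} := (hM v h0).2 ((add_mem_cancel_left hpM).1 hpvM)
  by_contra hmem
  exact hp ((span_singleton_le_iff_mem _ _).2 (mem_span_insert_exchange hFv hmem) (hΦ p hlp))

section Restriction

variable (hv₀ : l v₀ = 1)
include hv₀

theorem isAffineLift_add : IsAffineLift K K' fun u : LinearMap.ker l => F (v₀ + u) where
  ne_zero u := hF.ne_zero _ (linearForm_apply_add_ne_zero hv₀ u)
  exists_affineSubspace W := by
    obtain ⟨M, hM⟩ := hF.exists_submodule W
    refine ⟨M.toAffineSubspace.comap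
      (AffineMap.const K _ v₀ + (LinearMap.ker l).subtype.toAffineMap), fun u => ?_⟩
    simp [hM _ (hF.ne_zero _ (linearForm_apply_add_ne_zero hv₀ u)), AffineSubspace.mem_comap]

theorem noncollinearRange_add (hnc : NoncollinearRange K' F) :
    NoncollinearRange K' fun u : LinearMap.ker l => F (v₀ + u) := by
  intro a b
  obtain ⟨v, hlv, hv⟩ := hF.exists_notMem_span (linearForm_ne_zero hv₀) hnc a b
  obtain ⟨u, hu⟩ := exists_eq_smul_add_of_apply_ne_zero hv₀ hlv
  rw [hu, hF.smul_mem_iff hlv (linearForm_apply_add_ne_zero hv₀ u)] at hv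
  exact ⟨u, hv⟩

theorem mem_span_of_forall_add_mem_span {σ : K →+* K'} {Φ : V →ₛₗ[σ] V'}
    (hΦ : ∀ u : LinearMap.ker l, F (v₀ + u) ∈ K' ∙ Φ (v₀ + u)) {v : V} (hv : l v ≠ 0) :
    F v ∈ K' ∙ Φ v := by
  obtain ⟨u, hu⟩ := exists_eq_smul_add_of_apply_ne_zero hv₀ hv
  rw [hu, hF.smul_mem_iff hv (linearForm_apply_add_ne_zero hv₀ u), map_smulₛₗ,
    span_singleton_smul_eq ((map_ne_zero σ).2 hv).isUnit]
  exact hΦ u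

theorem exists_semilinear (hK : 4 ≤ #K ∨ (#K = 3 ∧ CharP K' 3)) (hnc : NoncollinearRange K' F) :
    ∃ (σ : K →+* K') (Φ : V →ₛₗ[σ] V'), ∀ v, F v ∈ K' ∙ Φ v := by
  obtain ⟨σ, Φ₀, hΦ₀⟩ :=
    (hF.isAffineLift_add hv₀).exists_semilinear hK (hF.noncollinearRange_add hv₀ hnc)
  obtain ⟨Φ, hΦ⟩ := exists_semilinear_extension hv₀ (F v₀) Φ₀
  refine ⟨σ, Φ, hF.mem_span_of_forall_apply_ne_zero (linearForm_ne_zero hv₀) hnc fun v =>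
    hF.mem_span_of_forall_add_mem_span hv₀ fun u => ?_⟩
  simpa [hΦ] using hΦ₀ u

theorem semilinear_eq_of_apply_eq (hK : 3 ≤ #K) (hnc : NoncollinearRange K' F)
    {σ τ : K →+* K'} {Φ : V →ₛₗ[σ] V'} {Ψ : V →ₛₗ[τ] V'} (hΦv₀ : Φ v₀ = F v₀) (hΨv₀ : Ψ v₀ = F v₀)
    (hΦ : ∀ v, F v ∈ K' ∙ Φ v) (hΨ : ∀ v, F v ∈ K' ∙ Ψ v) (v : V) : Φ v = Ψ v := by
  obtain ⟨rfl, hker⟩ := (hF.isAffineLift_add hv₀).ringHom_eq_and_forall_eq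
    (hF.noncollinearRange_add hv₀ hnc) hK
    (Φ := Φ.comp (LinearMap.ker l).subtype) (Ψ := Ψ.comp (LinearMap.ker l).subtype)
    (fun u => by simpa [hΦv₀] using hΦ (v₀ + u)) (fun u => by simpa [hΨv₀] using hΨ (v₀ + u))
  have hl : v - l v • v₀ ∈ LinearMap.ker l := by simp [hv₀]
  rw [← sub_add_cancel v (l v • v₀), map_add, map_add, map_smulₛₗ, map_smulₛₗ, hΦv₀, hΨv₀]
  exact congrArg (· + _) (hker ⟨_, hl⟩)

theorem span_apply_eq_span_apply (hK : 3 ≤ #K) (hnc : NoncollinearRange K' F)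
    {σ τ : K →+* K'} {Φ : V →ₛₗ[σ] V'} {Ψ : V →ₛₗ[τ] V'}
    (hΦ : ∀ v, F v ∈ K' ∙ Φ v) (hΨ : ∀ v, F v ∈ K' ∙ Ψ v) (v : V) : (K' ∙ Φ v) = K' ∙ Ψ v := by
  have hFv₀ : F v₀ ≠ 0 := hF.ne_zero v₀ (hv₀ ▸ one_ne_zero)
  obtain ⟨_, Φ', hΦ'v₀, hΦ'⟩ := exists_semilinear_apply_eq Φ hFv₀ (hΦ v₀)
  obtain ⟨_, Ψ', hΨ'v₀, hΨ'⟩ := exists_semilinear_apply_eq Ψ hFv₀ (hΨ v₀)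
  rw [← hΦ', ← hΨ', hF.semilinear_eq_of_apply_eq hv₀ hK hnc hΦ'v₀ hΨ'v₀
    (fun v => hΦ' v ▸ hΦ v) fun v => hΨ' v ▸ hΨ v]

end Restriction

end IsAffinoProjectiveLift

end AffinoProjectiveLift

section ProjectiveInterface

open Submodule Projectivization

variable {K K' V V' : Type*} [DivisionRing K] [AddCommGroup V] [Module K V]
  [DivisionRing K'] [AddCommGroup V'] [Module K' V'] {X : Set (ℙ K V)} {f : X → ℙ K' V'}

theorem mem_projectivization_iff_rep_mem {W : Submodule K V} {x : ℙ K V} :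
    x ∈ W.projectivization ↔ x.rep ∈ W := by
  rw [← mk_mem_projectivization_iff W x.rep_nonzero, x.mk_rep]

theorem exists_linearForm_of_isHyperplane {H : Set (ℙ K V)}
    (hH : (projectiveGeometry K V).IsHyperplane H) :
    ∃ l : V →ₗ[K] K, l ≠ 0 ∧ ∀ v (hv : v ≠ 0), mk K v hv ∈ H → l v = 0 := by
  obtain ⟨⟨S, rfl⟩, hne, -⟩ := hH
  have hlt : S.submodule < ⊤ := by
    refine lt_top_iff_ne_top.2 fun h => hne (Set.eq_univ_of_forall fun x => ?_)
    have hx : x.rep ∈ S.submodule := h ▸ mem_top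
    rwa [Subspace.mem_submodule_iff S x.rep_nonzero, x.mk_rep] at hx
  obtain ⟨l, hl, hSl⟩ := exists_le_ker_of_lt_top _ hlt
  exact ⟨l, hl, fun v hv h => hSl ((S.mem_submodule_iff hv).2 h)⟩

theorem exists_linearForm_of_isAffinoProjective
    (hX : (projectiveGeometry K V).IsAffinoProjective X) :
    ∃ (l : V →ₗ[K] K) (v₀ : V), l v₀ = 1 ∧ ∀ v (hv : v ≠ 0), l v ≠ 0 → mk K v hv ∈ X := by
  obtain ⟨H, hH, hXH⟩ := hX
  obtain ⟨l, hl, hHl⟩ := exists_linearForm_of_isHyperplane hH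
  obtain ⟨v₀, hv₀⟩ := LinearMap.surjective hl 1
  exact ⟨l, v₀, hv₀, fun v hv hlv =>
    (hXH ▸ Set.mem_univ (mk K v hv) : mk K v hv ∈ X ∪ H).resolve_right (mt (hHl v hv) hlv)⟩

open Classical in
/-- The chosen representing vector of the value `f ⟨v⟩`, with the value `0` when `v` spans no point
of the domain `X`. -/
noncomputable def representative (f : X → ℙ K' V') (v : V) : V' :=
  if h : ∃ hv : v ≠ 0, mk K v hv ∈ X then (f ⟨mk K v h.choose, h.choose_spec⟩).rep else 0

theorem representative_apply (f : X → ℙ K' V') {v : V} (hv : v ≠ 0) (hx : mk K v hv ∈ X) :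
    representative f v = (f ⟨mk K v hv, hx⟩).rep :=
  dif_pos ⟨hv, hx⟩

theorem representative_ne_zero_iff {v : V} :
    representative f v ≠ 0 ↔ ∃ hv : v ≠ 0, mk K v hv ∈ X := by
  refine ⟨not_imp_comm.1 fun h => dif_neg h, fun ⟨hv, hx⟩ => ?_⟩
  rw [representative_apply f hv hx]
  exact rep_nonzero _

theorem isAffinoProjectiveLift_representative {l : V →ₗ[K] K}
    (hl : ∀ v (hv : v ≠ 0), l v ≠ 0 → mk K v hv ∈ X)
    (hf : ((projectiveGeometry K V).subgeometry X).IsMorphism (projectiveGeometry K' V') f) :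
    IsAffinoProjectiveLift K' l (representative f) where
  ne_zero v hlv :=
    have hv : v ≠ 0 := fun h => hlv (h ▸ map_zero l)
    representative_ne_zero_iff.2 ⟨hv, hl v hv hlv⟩
  exists_submodule W := by
    obtain ⟨_, ⟨S, rfl⟩, hS⟩ := hf (W.projectivization : Set (ℙ K' V')) ⟨_, rfl⟩
    refine ⟨S.submodule, fun v h => ?_⟩
    obtain ⟨hv, hx⟩ := representative_ne_zero_iff.1 h
    rw [representative_apply f hv hx, ← mem_projectivization_iff_rep_mem, S.mem_submodule_iff hv]
    exact Set.ext_iff.1 hS ⟨_, hx⟩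

theorem exists_rep_notMem_span_pair {S : Set (ℙ K V)} (hS : ¬ IsCollinear S) (a b : V) :
    ∃ x ∈ S, x.rep ∉ span K {a, b} := by
  by_contra! h
  refine hS ⟨(span K {a, b}).projectivization, ?_, ?_, fun x hx =>
    mem_projectivization_iff_rep_mem.2 (h x hx)⟩ <;>
    rw [Subspace.submodule.apply_symm_apply]
  · exact Module.Finite.span_of_finite K (Set.toFinite _)
  · classical
    exact (finrank_span_le_card _).trans (by simpa using Finset.card_le_two)

theorem noncollinearRange_representative (hline : ¬ IsCollinear (Set.range f)) :
    NoncollinearRange K' (representative f) := by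
  intro a b
  obtain ⟨_, ⟨⟨x, hx⟩, rfl⟩, hab⟩ := exists_rep_notMem_span_pair hline a b
  induction x with
  | h v hv => exact ⟨v, representative_apply f hv hx ▸ hab⟩

section PartialProjectivization

variable {σ τ : K →+* K'} {Φ : V →ₛₗ[σ] V'} {Ψ : V →ₛₗ[τ] V'}

theorem mem_partialProjectivization_mk_iff_rep_mem {v : V} (hv : v ≠ 0) {y : ℙ K' V'} :
    y ∈ partialProjectivization Φ (mk K v hv) ↔ y.rep ∈ K' ∙ Φ v := by
  rw [mem_partialProjectivization_mk, mem_span_singleton]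
  constructor
  · rintro ⟨h, rfl⟩
    obtain ⟨a, ha⟩ := exists_smul_eq_mk_rep K' (Φ v) h
    exact ⟨a, ha⟩
  · rintro ⟨a, ha⟩
    have h : Φ v ≠ 0 := fun h => y.rep_nonzero (by rw [← ha, h, smul_zero])
    exact ⟨h, by rw [← y.mk_rep, mk_eq_mk_iff']; exact ⟨a, ha⟩⟩

theorem forall_mem_partialProjectivization_iff :
    (∀ x : X, f x ∈ partialProjectivization Φ x) ↔ ∀ v, representative f v ∈ K' ∙ Φ v := by
  constructor
  · intro h v
    rcases eq_or_ne (representative f v) 0 with h0 | h0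
    · exact h0 ▸ zero_mem _
    obtain ⟨hv, hx⟩ := representative_ne_zero_iff.1 h0
    rw [representative_apply f hv hx, ← mem_partialProjectivization_mk_iff_rep_mem hv]
    exact h ⟨_, hx⟩
  · rintro h ⟨x, hx⟩
    induction x with
    | h v hv =>
      rw [mem_partialProjectivization_mk_iff_rep_mem hv, ← representative_apply f hv hx]
      exact h v

theorem partialProjectivization_congr (h : ∀ v, (K' ∙ Φ v) = K' ∙ Ψ v) :
    partialProjectivization Φ = partialProjectivization Ψ := by
  refine PFun.ext fun x y => ?_
  induction x with
  | h v hv => simp only [mem_partialProjectivization_mk_iff_rep_mem, h]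

end PartialProjectivization

end ProjectiveInterface

theorem proposition5p2 {K V K' V' : Type*}
    [DivisionRing K] [AddCommGroup V] [Module K V]
    [DivisionRing K'] [AddCommGroup V'] [Module K' V']
    (hK : 4 ≤ Cardinal.mk K ∨ (Cardinal.mk K = 3 ∧ CharP K' 3))
    (X : Set (ℙ K V)) (hX : (projectiveGeometry K V).IsAffinoProjective X)
    (f : X → ℙ K' V')
    (hf : ((projectiveGeometry K V).subgeometry X).IsMorphism (projectiveGeometry K' V') f)
    (hline : ¬ Projectivization.IsCollinear (Set.range f)) :
    ∃! φ : ℙ K V →. ℙ K' V', IsPartialProjectiveMorphism φ ∧ ∀ x : X, f x ∈ φ x := by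
  obtain ⟨l, v₀, hv₀, hl⟩ := exists_linearForm_of_isAffinoProjective hX
  have hF : IsAffinoProjectiveLift K' l (representative f) :=
    isAffinoProjectiveLift_representative hl hf
  have hnc : NoncollinearRange K' (representative f) := noncollinearRange_representative hline
  obtain ⟨σ, Φ, hΦ⟩ := hF.exists_semilinear hv₀ hK hnc
  refine ⟨partialProjectivization Φ,
    ⟨⟨σ, Φ, rfl⟩, forall_mem_partialProjectivization_iff.2 hΦ⟩, ?_⟩
  rintro _ ⟨⟨τ, Ψ, rfl⟩, hΨ⟩
  exact partialProjectivization_congr (hF.span_apply_eq_span_apply hv₀ (three_le_card hK) hnc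
    (forall_mem_partialProjectivization_iff.1 hΨ) hΦ)
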